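/- Let $n\ge 1$ and let $n\mathbf{Web}$ be the $\mathfrak{sl}_n$ web skein module: the $\mathbb{Z}[q,q^{-1}]$-module of linear combinations of planar oriented trivalent graphs with edges labelled by $1,\dots,n$ and flow preserved at vertices ($0$-labelled edges are erased, graphs with a label above $n$ are zero), up to planar isotopy and the relations (i) a digon with edges $k,l$ equals $\binom{k+l}{l}_q$ times a $(k+l)$-strand, and a loop labelled $l$ attached (on either side, through an edge labelled $k+l$) to a $k$-strand equals $\binom{n-k}{l}_q$ times the $k$-strand (for $k=0$: an $l$-labelled circle equals $\binom{n}{l}_q$); (ii) merging and splitting of strands are associative; (iii) in a two-strand ladder with bottom labels $(k,l)$, with $E^{(s)}$ (resp. $F^{(s)}$) the rung carrying $s$ from left to right (resp. right to left), $E^{(r)}E^{(s)}=\binom{r+s}{r}_q E^{(r+s)}$ and $F^{(r)}E^{(s)}=\sum_{t}\binom{k-l+r-s}{t}_q E^{(s-t)}F^{(r-t)}$ (rightmost factor at the bottom), together with their mirror images; (iv) two antiparallel $n$-strands equal the corresponding cap-cup pair. Here $[m]=\frac{q^m-q^{-m}}{q-q^{-1}}$ and $\binom{p}{t}_q=\frac{[p][p-1]\cdots[p-t+1]}{[t]!}$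 for $p\in\mathbb{Z}$, $t\ge 0$. Let $\Psi_{T_i}$ be the map from diagrams of web-tangles to $n\mathbf{Web}$ that smooths each crossing locally. A positive crossing of upward strands, with bottom labels $(k,l)$ and the strand from bottom left to top right over, is replaced by $$\sum_{a-b+c=k-l}(-1)^{b-l}q^{-ac+b-l}\,E^{(a)}F^{(b)}E^{(c)},$$ and a negative one (bottom labels $(k,l)$, the strand from bottom right to top left over) by $$\sum_{a-b+c=l-k}(-1)^{b+k}q^{ac-b+k}\,F^{(a)}E^{(b)}F^{(c)},$$ the sums being over $a,b,c\ge 0$. Then for all $1\le k\le n$ a positive framing twist on a $k$-labelled strand acts by multiplication by $$t_k=(-1)^k q^{-kn}q^{k(k-1)}.$$ That is, if $C_k$ denotes the $k$-labelled upward strand with one positive curl (a positive crossing of the strand with itself, whose two right ends, or whose two left ends, are joined by an arc), then $\Psi_{T_i}(C_k)=t_k\cdot(\text{the plain }k\text{-labelled strand})$ in $n\mathbf{Web}$, for both curls. -/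

import Mathlib

open CategoryTheory MonoidalCategory

namespace SkeinWeb

/-- The ground ring `ℤ[q, q⁻¹]`; the power `q ^ m` is `LaurentPolynomial.T m`. -/
abbrev QRing : Type := LaurentPolynomial ℤ

/-- The power `q ^ m` for an integer `m`. -/
noncomputable def qpow (m : ℤ) : QRing := LaurentPolynomial.T m

/-- The balanced quantum binomial coefficient with natural upper entry, by the `q`-Pascal rule. -/
noncomputable def qbinomNat : ℕ → ℕ → QRing
  | _, 0 => 1
  | 0, _ + 1 => 0
  | m + 1, k + 1 =>
      qpow ((k : ℤ) + 1) * qbinomNat m (k + 1) + qpow ((k : ℤ) - (m : ℤ)) * qbinomNat m k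

/-- The balanced quantum binomial coefficient `[p][p-1]⋯[p-t+1] / [t]!` for any integer `p`
(see `qbinom_spec`). -/
noncomputable def qbinom : ℤ → ℕ → QRing
  | Int.ofNat m, t => qbinomNat m t
  | Int.negSucc m, t => (-1) ^ t * qbinomNat (m + t) t

/-- `(q - q⁻¹) [x] = q ^ x - q ^ (-x)`. -/
noncomputable def qdiff (x : ℤ) : QRing := qpow x - qpow (-x)

theorem qpow_add (a b : ℤ) : qpow (a + b) = qpow a * qpow b := LaurentPolynomial.T_add a b

theorem qpow_zero : qpow 0 = 1 := LaurentPolynomial.T_zero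

theorem qbinomNat_spec (m t : ℕ) :
    qbinomNat m t * ∏ i ∈ Finset.range t, qdiff ((i : ℤ) + 1) =
      ∏ i ∈ Finset.range t, qdiff ((m : ℤ) - i) := by
  induction m generalizing t with
  | zero =>
    cases t with
    | zero => simp [qbinomNat]
    | succ k =>
      rw [Finset.prod_range_succ' (fun i : ℕ => qdiff (((0 : ℕ) : ℤ) - i))]
      simp [qbinomNat, qdiff]
  | succ m ih =>
    cases t with
    | zero => simp [qbinomNat]
    | succ k =>
      have h1 := ih (k + 1)
      have h2 := ih k
      rw [Finset.prod_range_succ, Finset.prod_range_succ] at h1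
      rw [Finset.prod_range_succ, Finset.prod_range_succ']
      have h3 : ∀ i : ℕ, ((m + 1 : ℕ) : ℤ) - ((i + 1 : ℕ) : ℤ) = (m : ℤ) - i := by
        intro i; push_cast; ring
      simp only [h3]
      have h4 : qpow ((k : ℤ) + 1) * qdiff ((m : ℤ) - k)
          + qpow ((k : ℤ) - (m : ℤ)) * qdiff ((k : ℤ) + 1) =
          qdiff (((m + 1 : ℕ) : ℤ) - ((0 : ℕ) : ℤ)) := by
        simp only [qdiff, mul_sub, ← qpow_add]
        push_cast
        ring_nf
      rw [← h4]
      simp only [qbinomNat]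
      linear_combination qpow ((k : ℤ) + 1) * h1
        + qpow ((k : ℤ) - (m : ℤ)) * qdiff ((k : ℤ) + 1) * h2

/-- The quantum binomial is `[p][p-1]⋯[p-t+1] / ([1][2]⋯[t])`, the common factors
`(q - q⁻¹) ^ t` being kept on both sides. -/
theorem qbinom_spec (p : ℤ) (t : ℕ) :
    qbinom p t * ∏ i ∈ Finset.range t, qdiff ((i : ℤ) + 1) =
      ∏ i ∈ Finset.range t, qdiff (p - i) := by
  cases p with
  | ofNat m => exact qbinomNat_spec m t
  | negSucc m =>
    simp only [qbinom]
    rw [mul_assoc, qbinomNat_spec, ← Finset.prod_range_reflect,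
      ← Finset.card_range t, ← Finset.prod_const, Finset.card_range, ← Finset.prod_mul_distrib]
    refine Finset.prod_congr rfl fun i hi => ?_
    have hi' := Finset.mem_range.1 hi
    have h : ((m + t : ℕ) : ℤ) - ((t - 1 - i : ℕ) : ℤ) = -(Int.negSucc m - i) := by
      rw [Int.negSucc_eq]; omega
    rw [h]
    simp [qdiff]

/-- Boundary sequences of webs: words (with brackets) in oriented points with labels in `ℕ`;
`up k` is a `k`-labelled strand oriented upward, `down k` one oriented downward.  Strands labelled
`0` are identified with the empty diagram, and strands with a label above `n` are set to zero, by
relations in `WebRel`, so the labels that matter are `1, …, n`. -/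
inductive NWeb (n : ℕ) : Type
  | unit : NWeb n
  | up (k : ℕ) : NWeb n
  | down (k : ℕ) : NWeb n
  | tensor (X Y : NWeb n) : NWeb n

open NWeb

/-- Formal `ℤ[q, q⁻¹]`-linear combinations of planar web diagrams, read from bottom to top, built
by vertical composition and juxtaposition from cups, caps and trivalent vertices.  The names `UD`
and `DU` give the orientations (up or down) of the left and of the right end of a cup or a cap. -/
inductive WebTerm (n : ℕ) : NWeb n → NWeb n → Type
  | id (X : NWeb n) : WebTerm n X X
  | comp {X Y Z : NWeb n} (f : WebTerm n X Y) (g : WebTerm n Y Z) : WebTerm n X Z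
  | tensor {X Y X' Y' : NWeb n} (f : WebTerm n X Y) (g : WebTerm n X' Y') :
      WebTerm n (X.tensor X') (Y.tensor Y')
  | assocHom (X Y Z : NWeb n) : WebTerm n ((X.tensor Y).tensor Z) (X.tensor (Y.tensor Z))
  | assocInv (X Y Z : NWeb n) : WebTerm n (X.tensor (Y.tensor Z)) ((X.tensor Y).tensor Z)
  | leftHom (X : NWeb n) : WebTerm n (unit.tensor X) X
  | leftInv (X : NWeb n) : WebTerm n X (unit.tensor X)
  | rightHom (X : NWeb n) : WebTerm n (X.tensor unit) X
  | rightInv (X : NWeb n) : WebTerm n X (X.tensor unit)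
  | zero (X Y : NWeb n) : WebTerm n X Y
  | add {X Y : NWeb n} (f g : WebTerm n X Y) : WebTerm n X Y
  | smul {X Y : NWeb n} (c : QRing) (f : WebTerm n X Y) : WebTerm n X Y
  | cupUD (k : ℕ) : WebTerm n unit ((up k).tensor (down k))
  | cupDU (k : ℕ) : WebTerm n unit ((down k).tensor (up k))
  | capUD (k : ℕ) : WebTerm n ((up k).tensor (down k)) unit
  | capDU (k : ℕ) : WebTerm n ((down k).tensor (up k)) unit
  /-- the vertex with incoming edges `k`, `l` and outgoing edge `m = k + l` -/
  | merge (k l m : ℕ) (h : k + l = m) : WebTerm n ((up k).tensor (up l)) (up m)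
  /-- the vertex with incoming edge `m = k + l` and outgoing edges `k`, `l` -/
  | split (k l m : ℕ) (h : k + l = m) : WebTerm n (up m) ((up k).tensor (up l))
  /-- the beginning of a strand labelled `0` (an invisible strand) -/
  | zeroIn : WebTerm n unit (up 0)
  /-- the end of a strand labelled `0` -/
  | zeroOut : WebTerm n (up 0) unit

namespace WebTerm

local infixr:80 " ≫ₜ " => WebTerm.comp
local infixr:90 " ⊗ₜ " => WebTerm.tensor

variable {n : ℕ}

/-- `f 0 + f 1 + ⋯ + f (m - 1)` -/
def sum {X Y : NWeb n} (f : ℕ → WebTerm n X Y) : ℕ → WebTerm n X Y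
  | 0 => zero X Y
  | m + 1 => add (sum f m) (f m)

/-- The rung carrying `s` from the left upright to the right upright of a two-strand ladder, from
labels `(k, l)` to `(k', l') = (k - s, l + s)`; it is zero if the labels do not fit (in particular
if `k < s`). -/
def rungRight (s k l k' l' : ℕ) :
    WebTerm n ((up k).tensor (up l)) ((up k').tensor (up l')) :=
  if h : k' + s = k ∧ s + l = l' then
    (split k' s k h.1 ⊗ₜ id (up l)) ≫ₜ assocHom _ _ _ ≫ₜ (id (up k') ⊗ₜ merge s l l' h.2)
  else zero _ _

/-- The rung carrying `s` from the right upright to the left upright of a two-strand ladder, from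
labels `(k, l)` to `(k', l') = (k + s, l - s)`; it is zero if the labels do not fit (in particular
if `l < s`). -/
def rungLeft (s k l k' l' : ℕ) :
    WebTerm n ((up k).tensor (up l)) ((up k').tensor (up l')) :=
  if h : k + s = k' ∧ s + l' = l then
    (id (up k) ⊗ₜ split s l' l h.2) ≫ₜ assocInv _ _ _ ≫ₜ (merge k s k' h.1 ⊗ₜ id (up l'))
  else zero _ _

/-- Rotation of `f` by a half turn, its input `X` being bent up to the right with the cup `η` and
its output `Y` being bent down to the left with the cap `ε`. -/
def rotateLeft {X Y X' Y' : NWeb n} (η : WebTerm n unit (X.tensor X'))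
    (ε : WebTerm n (Y'.tensor Y) unit) (f : WebTerm n X Y) : WebTerm n Y' X' :=
  rightInv Y' ≫ₜ (id Y' ⊗ₜ η) ≫ₜ (id Y' ⊗ₜ (f ⊗ₜ id X')) ≫ₜ assocInv _ _ _ ≫ₜ
    (ε ⊗ₜ id X') ≫ₜ leftHom X'

/-- Rotation of `f` by a half turn in the other direction. -/
def rotateRight {X Y X' Y' : NWeb n} (η : WebTerm n unit (X'.tensor X))
    (ε : WebTerm n (Y.tensor Y') unit) (f : WebTerm n X Y) : WebTerm n Y' X' :=
  leftInv Y' ≫ₜ (η ⊗ₜ id Y') ≫ₜ ((id X' ⊗ₜ f) ⊗ₜ id Y') ≫ₜ assocHom _ _ _ ≫ₜ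
    (id X' ⊗ₜ ε) ≫ₜ rightHom X'

/-- two nested cups -/
def cupUD₂ (k l : ℕ) :
    WebTerm n unit (((up k).tensor (up l)).tensor ((down l).tensor (down k))) :=
  cupUD k ≫ₜ (id (up k) ⊗ₜ leftInv (down k)) ≫ₜ (id (up k) ⊗ₜ (cupUD l ⊗ₜ id (down k))) ≫ₜ
    (id (up k) ⊗ₜ assocHom _ _ _) ≫ₜ assocInv _ _ _

/-- two nested cups -/
def cupDU₂ (k l : ℕ) :
    WebTerm n unit (((down l).tensor (down k)).tensor ((up k).tensor (up l))) :=
  cupDU l ≫ₜ (id (down l) ⊗ₜ leftInv (up l)) ≫ₜ (id (down l) ⊗ₜ (cupDU k ⊗ₜ id (up l))) ≫ₜ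
    (id (down l) ⊗ₜ assocHom _ _ _) ≫ₜ assocInv _ _ _

/-- two nested caps -/
def capUD₂ (k l : ℕ) :
    WebTerm n (((up k).tensor (up l)).tensor ((down l).tensor (down k))) unit :=
  assocHom _ _ _ ≫ₜ (id (up k) ⊗ₜ assocInv _ _ _) ≫ₜ
    (id (up k) ⊗ₜ (capUD l ⊗ₜ id (down k))) ≫ₜ (id (up k) ⊗ₜ leftHom (down k)) ≫ₜ capUD k

/-- two nested caps -/
def capDU₂ (k l : ℕ) :
    WebTerm n (((down l).tensor (down k)).tensor ((up k).tensor (up l))) unit :=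
  assocHom _ _ _ ≫ₜ (id (down l) ⊗ₜ assocInv _ _ _) ≫ₜ
    (id (down l) ⊗ₜ (capDU k ⊗ₜ id (up l))) ≫ₜ (id (down l) ⊗ₜ leftHom (up l)) ≫ₜ capDU l

end WebTerm

open WebTerm

local infixr:80 " ≫ₜ " => WebTerm.comp
local infixr:90 " ⊗ₜ " => WebTerm.tensor

/-- The relations between linear combinations of webs.  The skein module is the quotient by the
equivalence relation that they generate. -/
inductive WebRel (n : ℕ) : {X Y : NWeb n} → WebTerm n X Y → WebTerm n X Y → Prop
  -- compatibility with the operations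
  | compLeft {X Y Z : NWeb n} {f f' : WebTerm n X Y} (g : WebTerm n Y Z) :
      WebRel n f f' → WebRel n (f ≫ₜ g) (f' ≫ₜ g)
  | compRight {X Y Z : NWeb n} (f : WebTerm n X Y) {g g' : WebTerm n Y Z} :
      WebRel n g g' → WebRel n (f ≫ₜ g) (f ≫ₜ g')
  | tensorLeft {X Y X' Y' : NWeb n} {f f' : WebTerm n X Y} (g : WebTerm n X' Y') :
      WebRel n f f' → WebRel n (f ⊗ₜ g) (f' ⊗ₜ g)
  | tensorRight {X Y X' Y' : NWeb n} (f : WebTerm n X Y) {g g' : WebTerm n X' Y'} :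
      WebRel n g g' → WebRel n (f ⊗ₜ g) (f ⊗ₜ g')
  | addLeft {X Y : NWeb n} {f f' : WebTerm n X Y} (g : WebTerm n X Y) :
      WebRel n f f' → WebRel n (add f g) (add f' g)
  | addRight {X Y : NWeb n} (f : WebTerm n X Y) {g g' : WebTerm n X Y} :
      WebRel n g g' → WebRel n (add f g) (add f g')
  | smulCongr {X Y : NWeb n} (c : QRing) {f f' : WebTerm n X Y} :
      WebRel n f f' → WebRel n (smul c f) (smul c f')
  -- module structure
  | add_assoc {X Y : NWeb n} (f g h : WebTerm n X Y) :
      WebRel n (add (add f g) h) (add f (add g h))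
  | add_comm {X Y : NWeb n} (f g : WebTerm n X Y) : WebRel n (add f g) (add g f)
  | zero_add {X Y : NWeb n} (f : WebTerm n X Y) : WebRel n (add (zero X Y) f) f
  | zero_smul {X Y : NWeb n} (f : WebTerm n X Y) : WebRel n (smul 0 f) (zero X Y)
  | one_smul {X Y : NWeb n} (f : WebTerm n X Y) : WebRel n (smul 1 f) f
  | mul_smul {X Y : NWeb n} (c d : QRing) (f : WebTerm n X Y) :
      WebRel n (smul (c * d) f) (smul c (smul d f))
  | add_smul {X Y : NWeb n} (c d : QRing) (f : WebTerm n X Y) :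
      WebRel n (smul (c + d) f) (add (smul c f) (smul d f))
  | smul_add {X Y : NWeb n} (c : QRing) (f g : WebTerm n X Y) :
      WebRel n (smul c (add f g)) (add (smul c f) (smul c g))
  -- bilinearity of vertical composition and juxtaposition
  | add_comp {X Y Z : NWeb n} (f f' : WebTerm n X Y) (g : WebTerm n Y Z) :
      WebRel n (add f f' ≫ₜ g) (add (f ≫ₜ g) (f' ≫ₜ g))
  | comp_add {X Y Z : NWeb n} (f : WebTerm n X Y) (g g' : WebTerm n Y Z) :
      WebRel n (f ≫ₜ add g g') (add (f ≫ₜ g) (f ≫ₜ g'))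
  | smul_comp {X Y Z : NWeb n} (c : QRing) (f : WebTerm n X Y) (g : WebTerm n Y Z) :
      WebRel n (smul c f ≫ₜ g) (smul c (f ≫ₜ g))
  | comp_smul {X Y Z : NWeb n} (c : QRing) (f : WebTerm n X Y) (g : WebTerm n Y Z) :
      WebRel n (f ≫ₜ smul c g) (smul c (f ≫ₜ g))
  | add_tensor {X Y X' Y' : NWeb n} (f f' : WebTerm n X Y) (g : WebTerm n X' Y') :
      WebRel n (add f f' ⊗ₜ g) (add (f ⊗ₜ g) (f' ⊗ₜ g))
  | tensor_add {X Y X' Y' : NWeb n} (f : WebTerm n X Y) (g g' : WebTerm n X' Y') :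
      WebRel n (f ⊗ₜ add g g') (add (f ⊗ₜ g) (f ⊗ₜ g'))
  | smul_tensor {X Y X' Y' : NWeb n} (c : QRing) (f : WebTerm n X Y) (g : WebTerm n X' Y') :
      WebRel n (smul c f ⊗ₜ g) (smul c (f ⊗ₜ g))
  | tensor_smul {X Y X' Y' : NWeb n} (c : QRing) (f : WebTerm n X Y) (g : WebTerm n X' Y') :
      WebRel n (f ⊗ₜ smul c g) (smul c (f ⊗ₜ g))
  -- planar isotopy: the axioms of a monoidal category
  | id_comp {X Y : NWeb n} (f : WebTerm n X Y) : WebRel n (id X ≫ₜ f) f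
  | comp_id {X Y : NWeb n} (f : WebTerm n X Y) : WebRel n (f ≫ₜ id Y) f
  | comp_assoc {W X Y Z : NWeb n} (f : WebTerm n W X) (g : WebTerm n X Y) (h : WebTerm n Y Z) :
      WebRel n ((f ≫ₜ g) ≫ₜ h) (f ≫ₜ (g ≫ₜ h))
  | tensor_id (X Y : NWeb n) : WebRel n (id X ⊗ₜ id Y) (id (X.tensor Y))
  | tensor_comp {X Y Z X' Y' Z' : NWeb n} (f : WebTerm n X Y) (f' : WebTerm n X' Y')
      (g : WebTerm n Y Z) (g' : WebTerm n Y' Z') :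
      WebRel n ((f ⊗ₜ f') ≫ₜ (g ⊗ₜ g')) ((f ≫ₜ g) ⊗ₜ (f' ≫ₜ g'))
  | assoc_hom_inv (X Y Z : NWeb n) :
      WebRel n (assocHom X Y Z ≫ₜ assocInv X Y Z) (id ((X.tensor Y).tensor Z))
  | assoc_inv_hom (X Y Z : NWeb n) :
      WebRel n (assocInv X Y Z ≫ₜ assocHom X Y Z) (id (X.tensor (Y.tensor Z)))
  | left_hom_inv (X : NWeb n) : WebRel n (leftHom X ≫ₜ leftInv X) (id (unit.tensor X))
  | left_inv_hom (X : NWeb n) : WebRel n (leftInv X ≫ₜ leftHom X) (id X)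
  | right_hom_inv (X : NWeb n) : WebRel n (rightHom X ≫ₜ rightInv X) (id (X.tensor unit))
  | right_inv_hom (X : NWeb n) : WebRel n (rightInv X ≫ₜ rightHom X) (id X)
  | assoc_naturality {X Y Z X' Y' Z' : NWeb n} (f : WebTerm n X X') (g : WebTerm n Y Y')
      (h : WebTerm n Z Z') :
      WebRel n (((f ⊗ₜ g) ⊗ₜ h) ≫ₜ assocHom X' Y' Z') (assocHom X Y Z ≫ₜ (f ⊗ₜ (g ⊗ₜ h)))
  | left_naturality {X Y : NWeb n} (f : WebTerm n X Y) :
      WebRel n ((id unit ⊗ₜ f) ≫ₜ leftHom Y) (leftHom X ≫ₜ f)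
  | right_naturality {X Y : NWeb n} (f : WebTerm n X Y) :
      WebRel n ((f ⊗ₜ id unit) ≫ₜ rightHom Y) (rightHom X ≫ₜ f)
  | pentagon (W X Y Z : NWeb n) :
      WebRel n ((assocHom W X Y ⊗ₜ id Z) ≫ₜ assocHom W (X.tensor Y) Z ≫ₜ
          (id W ⊗ₜ assocHom X Y Z))
        (assocHom (W.tensor X) Y Z ≫ₜ assocHom W X (Y.tensor Z))
  | triangle (X Y : NWeb n) :
      WebRel n (assocHom X unit Y ≫ₜ (id X ⊗ₜ leftHom Y)) (rightHom X ⊗ₜ id Y)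
  -- planar isotopy: straightening of strands
  | zigzag_down (k : ℕ) : WebRel n (rotateLeft (cupUD k) (capDU k) (id (up k))) (id (down k))
  | zigzag_up (k : ℕ) : WebRel n (rotateRight (cupUD k) (capDU k) (id (down k))) (id (up k))
  | zigzag_up' (k : ℕ) : WebRel n (rotateLeft (cupDU k) (capUD k) (id (down k))) (id (up k))
  | zigzag_down' (k : ℕ) : WebRel n (rotateRight (cupDU k) (capUD k) (id (up k))) (id (down k))
  -- planar isotopy: the two rotations of a vertex by a half turn agree
  | rotate_merge (k l m : ℕ) (h : k + l = m) :
      WebRel n (rotateLeft (cupUD₂ k l) (capDU m) (merge k l m h))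
        (rotateRight (cupDU₂ k l) (capUD m) (merge k l m h))
  | rotate_split (k l m : ℕ) (h : k + l = m) :
      WebRel n (rotateLeft (cupUD m) (capDU₂ k l) (split k l m h))
        (rotateRight (cupDU m) (capUD₂ k l) (split k l m h))
  -- strands labelled `0` are erased
  | zero_in_out : WebRel n (zeroIn ≫ₜ zeroOut) (id unit)
  | zero_out_in : WebRel n (zeroOut ≫ₜ zeroIn) (id (up 0))
  | rotate_zeroIn :
      WebRel n (rotateLeft (leftInv unit) (capDU 0) zeroIn)
        (rotateRight (leftInv unit) (capUD 0) zeroIn)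
  | rotate_zeroOut :
      WebRel n (rotateLeft (cupUD 0) (leftHom unit) zeroOut)
        (rotateRight (cupDU 0) (leftHom unit) zeroOut)
  | zero_merge (k : ℕ) :
      WebRel n ((zeroIn ⊗ₜ id (up k)) ≫ₜ merge 0 k k (Nat.zero_add k)) (leftHom (up k))
  | merge_zero (k : ℕ) :
      WebRel n ((id (up k) ⊗ₜ zeroIn) ≫ₜ merge k 0 k (Nat.add_zero k)) (rightHom (up k))
  | zero_split (k : ℕ) :
      WebRel n (split 0 k k (Nat.zero_add k) ≫ₜ (zeroOut ⊗ₜ id (up k))) (leftInv (up k))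
  | split_zero (k : ℕ) :
      WebRel n (split k 0 k (Nat.add_zero k) ≫ₜ (id (up k) ⊗ₜ zeroOut)) (rightInv (up k))
  -- webs with a label above `n` are zero
  | large (k : ℕ) (h : n < k) : WebRel n (id (up k)) (zero _ _)
  -- removal of a digon
  | digon (k l m : ℕ) (h : k + l = m) :
      WebRel n (split k l m h ≫ₜ merge k l m h) (smul (qbinom (m : ℤ) l) (id (up m)))
  -- removal of a loop labelled `l` to the left, or to the right, of a strand labelled `k`
  | loop_left (k l m : ℕ) (h : l + k = m) :
      WebRel n (leftInv (up k) ≫ₜ (cupDU l ⊗ₜ id (up k)) ≫ₜ assocHom _ _ _ ≫ₜ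
          (id (down l) ⊗ₜ (merge l k m h ≫ₜ split l k m h)) ≫ₜ assocInv _ _ _ ≫ₜ
          (capDU l ⊗ₜ id (up k)) ≫ₜ leftHom (up k))
        (smul (qbinom ((n : ℤ) - k) l) (id (up k)))
  | loop_right (k l m : ℕ) (h : k + l = m) :
      WebRel n (rightInv (up k) ≫ₜ (id (up k) ⊗ₜ cupUD l) ≫ₜ assocInv _ _ _ ≫ₜ
          ((merge k l m h ≫ₜ split k l m h) ⊗ₜ id (down l)) ≫ₜ assocHom _ _ _ ≫ₜ
          (id (up k) ⊗ₜ capUD l) ≫ₜ rightHom (up k))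
        (smul (qbinom ((n : ℤ) - k) l) (id (up k)))
  -- associativity of merging and of splitting
  | merge_assoc (k l m kl lm klm : ℕ) (h₁ : k + l = kl) (h₂ : kl + m = klm) (h₃ : l + m = lm)
      (h₄ : k + lm = klm) :
      WebRel n ((merge k l kl h₁ ⊗ₜ id (up m)) ≫ₜ merge kl m klm h₂)
        (assocHom _ _ _ ≫ₜ (id (up k) ⊗ₜ merge l m lm h₃) ≫ₜ merge k lm klm h₄)
  | split_assoc (k l m kl lm klm : ℕ) (h₁ : k + l = kl) (h₂ : kl + m = klm) (h₃ : l + m = lm)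
      (h₄ : k + lm = klm) :
      WebRel n (split kl m klm h₂ ≫ₜ (split k l kl h₁ ⊗ₜ id (up m)) ≫ₜ assocHom _ _ _)
        (split k lm klm h₄ ≫ₜ (id (up k) ⊗ₜ split l m lm h₃))
  -- two consecutive rungs in the same direction
  | rungRight_rungRight (r s k l k' l' : ℕ) :
      WebRel n (rungRight s k l (k - s) (l + s) ≫ₜ rungRight r (k - s) (l + s) k' l')
        (smul (qbinom ((r : ℤ) + s) r) (rungRight (r + s) k l k' l'))
  | rungLeft_rungLeft (r s k l k' l' : ℕ) :
      WebRel n (rungLeft s k l (k + s) (l - s) ≫ₜ rungLeft r (k + s) (l - s) k' l')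
        (smul (qbinom ((r : ℤ) + s) r) (rungLeft (r + s) k l k' l'))
  -- two consecutive rungs in opposite directions
  | rungRight_rungLeft (r s k l k' l' : ℕ) :
      WebRel n (rungRight s k l (k - s) (l + s) ≫ₜ rungLeft r (k - s) (l + s) k' l')
        (WebTerm.sum (fun t => smul (qbinom ((k : ℤ) - l + r - s) t)
          (rungLeft (r - t) k l (k + (r - t)) (l - (r - t)) ≫ₜ
            rungRight (s - t) (k + (r - t)) (l - (r - t)) k' l')) (min r s + 1))
  | rungLeft_rungRight (r s k l k' l' : ℕ) :
      WebRel n (rungLeft s k l (k + s) (l - s) ≫ₜ rungRight r (k + s) (l - s) k' l')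
        (WebTerm.sum (fun t => smul (qbinom ((l : ℤ) - k + r - s) t)
          (rungRight (r - t) k l (k - (r - t)) (l + (r - t)) ≫ₜ
            rungLeft (s - t) (k - (r - t)) (l + (r - t)) k' l')) (min r s + 1))
  -- two antiparallel strands labelled `n`
  | saddle_up_down :
      WebRel n (id ((up n).tensor (down n))) (capUD n ≫ₜ cupUD n)
  | saddle_down_up :
      WebRel n (id ((down n).tensor (up n))) (capDU n ≫ₜ cupDU n)

/-- The skein module of `𝔰𝔩_n` webs with bottom boundary `X` and top boundary `Y`. -/
def WebHom (n : ℕ) (X Y : NWeb n) : Type := Quot (WebRel n (X := X) (Y := Y))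

variable {n : ℕ}

/-- Vertical composition of webs, `f` below `g`. -/
def WebHom.comp {X Y Z : NWeb n} (f : WebHom n X Y) (g : WebHom n Y Z) : WebHom n X Z :=
  Quot.map₂ WebTerm.comp (fun f _ _ h => WebRel.compRight f h) (fun _ _ g h => WebRel.compLeft g h)
    f g

/-- Juxtaposition of webs, `f` to the left of `g`. -/
def WebHom.tensor {X Y X' Y' : NWeb n} (f : WebHom n X Y) (g : WebHom n X' Y') :
    WebHom n (X.tensor X') (Y.tensor Y') :=
  Quot.map₂ WebTerm.tensor (fun f _ _ h => WebRel.tensorRight f h)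
    (fun _ _ g h => WebRel.tensorLeft g h) f g

/-- The class of a linear combination of webs in the skein module. -/
def WebHom.mk {X Y : NWeb n} (f : WebTerm n X Y) : WebHom n X Y := Quot.mk _ f

instance : Category (NWeb n) where
  Hom X Y := WebHom n X Y
  id X := WebHom.mk (WebTerm.id X)
  comp f g := WebHom.comp f g
  id_comp := by rintro X Y ⟨f⟩; exact Quot.sound (WebRel.id_comp f)
  comp_id := by rintro X Y ⟨f⟩; exact Quot.sound (WebRel.comp_id f)
  assoc := by rintro W X Y Z ⟨f⟩ ⟨g⟩ ⟨h⟩; exact Quot.sound (WebRel.comp_assoc f g h)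

/-- The class of a linear combination of webs, as a morphism of the category of webs. -/
def web {X Y : NWeb n} (f : WebTerm n X Y) : X ⟶ Y := WebHom.mk f

instance : MonoidalCategoryStruct (NWeb n) where
  tensorObj := NWeb.tensor
  tensorUnit := NWeb.unit
  tensorHom f g := WebHom.tensor f g
  whiskerLeft X _ _ f := WebHom.tensor (WebHom.mk (WebTerm.id X)) f
  whiskerRight f Y := WebHom.tensor f (WebHom.mk (WebTerm.id Y))
  associator X Y Z :=
    { hom := web (assocHom X Y Z)
      inv := web (assocInv X Y Z)
      hom_inv_id := Quot.sound (WebRel.assoc_hom_inv X Y Z)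
      inv_hom_id := Quot.sound (WebRel.assoc_inv_hom X Y Z) }
  leftUnitor X :=
    { hom := web (leftHom X)
      inv := web (leftInv X)
      hom_inv_id := Quot.sound (WebRel.left_hom_inv X)
      inv_hom_id := Quot.sound (WebRel.left_inv_hom X) }
  rightUnitor X :=
    { hom := web (rightHom X)
      inv := web (rightInv X)
      hom_inv_id := Quot.sound (WebRel.right_hom_inv X)
      inv_hom_id := Quot.sound (WebRel.right_inv_hom X) }

instance : MonoidalCategory (NWeb n) :=
  MonoidalCategory.ofTensorHom
    (id_tensorHom_id := fun X Y => Quot.sound (WebRel.tensor_id X Y))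
    (id_tensorHom := fun _ _ _ _ => rfl)
    (tensorHom_id := fun _ _ => rfl)
    (tensorHom_comp_tensorHom := by
      rintro _ _ _ _ _ _ ⟨f⟩ ⟨f'⟩ ⟨g⟩ ⟨g'⟩; exact Quot.sound (WebRel.tensor_comp f f' g g'))
    (associator_naturality := by
      rintro _ _ _ _ _ _ ⟨f⟩ ⟨g⟩ ⟨h⟩; exact Quot.sound (WebRel.assoc_naturality f g h))
    (leftUnitor_naturality := by rintro _ _ ⟨f⟩; exact Quot.sound (WebRel.left_naturality f))
    (rightUnitor_naturality := by rintro _ _ ⟨f⟩; exact Quot.sound (WebRel.right_naturality f))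
    (pentagon := fun W X Y Z => Quot.sound (WebRel.pentagon W X Y Z))
    (triangle := fun X Y => Quot.sound (WebRel.triangle X Y))

instance (X Y : NWeb n) : Add (X ⟶ Y) where
  add f g := (Quot.map₂ WebTerm.add (fun f _ _ h => WebRel.addRight f h)
    (fun _ _ g h => WebRel.addLeft g h) f g : WebHom n X Y)

instance (X Y : NWeb n) : Zero (X ⟶ Y) where
  zero := web (WebTerm.zero X Y)

instance (X Y : NWeb n) : SMul QRing (X ⟶ Y) where
  smul c f := (Quot.map (WebTerm.smul c) (fun _ _ h => WebRel.smulCongr c h) f : WebHom n X Y)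

theorem hom_add_comm {X Y : NWeb n} (f g : X ⟶ Y) : f + g = g + f := by
  rcases f with ⟨f⟩; rcases g with ⟨g⟩; exact Quot.sound (WebRel.add_comm f g)

theorem hom_zero_add {X Y : NWeb n} (f : X ⟶ Y) : 0 + f = f := by
  rcases f with ⟨f⟩; exact Quot.sound (WebRel.zero_add f)

theorem hom_zero_smul {X Y : NWeb n} (f : X ⟶ Y) : (0 : QRing) • f = 0 := by
  rcases f with ⟨f⟩; exact Quot.sound (WebRel.zero_smul f)

theorem hom_one_smul {X Y : NWeb n} (f : X ⟶ Y) : (1 : QRing) • f = f := by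
  rcases f with ⟨f⟩; exact Quot.sound (WebRel.one_smul f)

theorem hom_add_smul {X Y : NWeb n} (c d : QRing) (f : X ⟶ Y) :
    (c + d) • f = c • f + d • f := by
  rcases f with ⟨f⟩; exact Quot.sound (WebRel.add_smul c d f)

theorem hom_mul_smul {X Y : NWeb n} (c d : QRing) (f : X ⟶ Y) :
    (c * d) • f = c • (d • f) := by
  rcases f with ⟨f⟩; exact Quot.sound (WebRel.mul_smul c d f)

theorem hom_smul_add {X Y : NWeb n} (c : QRing) (f g : X ⟶ Y) :
    c • (f + g) = c • f + c • g := by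
  rcases f with ⟨f⟩; rcases g with ⟨g⟩; exact Quot.sound (WebRel.smul_add c f g)

noncomputable instance (X Y : NWeb n) : Neg (X ⟶ Y) where
  neg f := (-1 : QRing) • f

theorem hom_neg_add {X Y : NWeb n} (f : X ⟶ Y) : -f + f = 0 := by
  change (-1 : QRing) • f + f = 0
  calc (-1 : QRing) • f + f = (-1 : QRing) • f + (1 : QRing) • f := by rw [hom_one_smul]
    _ = (-1 + 1 : QRing) • f := (hom_add_smul _ _ f).symm
    _ = 0 := by rw [neg_add_cancel, hom_zero_smul]

noncomputable instance (X Y : NWeb n) : AddCommGroup (X ⟶ Y) where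
  add_assoc := by rintro ⟨f⟩ ⟨g⟩ ⟨h⟩; exact Quot.sound (WebRel.add_assoc f g h)
  zero_add := hom_zero_add
  add_zero f := by rw [hom_add_comm, hom_zero_add]
  add_comm := hom_add_comm
  neg_add_cancel := hom_neg_add
  nsmul := nsmulRec
  zsmul := zsmulRec

noncomputable instance (X Y : NWeb n) : Module QRing (X ⟶ Y) where
  one_smul := hom_one_smul
  mul_smul := hom_mul_smul
  smul_add := hom_smul_add
  add_smul := hom_add_smul
  zero_smul := hom_zero_smul
  smul_zero c := by
    have h : (0 : X ⟶ Y) = (0 : QRing) • (0 : X ⟶ Y) := (hom_zero_smul _).symm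
    rw [h, ← hom_mul_smul, mul_zero]

noncomputable instance : Preadditive (NWeb n) where
  homGroup := inferInstance
  add_comp := by
    rintro X Y Z ⟨f⟩ ⟨f'⟩ ⟨g⟩; exact Quot.sound (WebRel.add_comp f f' g)
  comp_add := by
    rintro X Y Z ⟨f⟩ ⟨g⟩ ⟨g'⟩; exact Quot.sound (WebRel.comp_add f g g')

noncomputable instance : Linear QRing (NWeb n) where
  homModule := inferInstance
  smul_comp := by
    rintro X Y Z c ⟨f⟩ ⟨g⟩; exact Quot.sound (WebRel.smul_comp c f g)
  comp_smul := by
    rintro X Y Z ⟨f⟩ c ⟨g⟩; exact Quot.sound (WebRel.comp_smul c f g)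

/-- The smoothing of the positive crossing (the strand from bottom left to top right, labelled `k`,
is over the strand labelled `l`): the sum over `a, b, c ≥ 0` with `a - b + c = k - l` of
`(-1) ^ (b - l) q ^ (-ac + b - l)` times the ladder with rungs `c` to the right, `b` to the left
and `a` to the right.  The ladders with an index above `k + l` are zero. -/
noncomputable def posCrossing (n k l : ℕ) :
    ((up k ⊗ up l : NWeb n)) ⟶ (up l ⊗ up k : NWeb n) :=
  ∑ a ∈ Finset.range (k + l + 1), ∑ b ∈ Finset.range (k + l + 1),
    ∑ c ∈ Finset.range (k + l + 1),
      if a + c + l = k + b then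
        ((-1) ^ (b + l) * qpow (-((a : ℤ) * c) + b - l) : QRing) •
          (web (rungRight c k l (k - c) (l + c)) ≫
            web (rungLeft b (k - c) (l + c) (k - c + b) (l + c - b)) ≫
            web (rungRight a (k - c + b) (l + c - b) l k))
      else 0

/-- The smoothing of the negative crossing (the strand from bottom right to top left, labelled `l`,
is over the strand labelled `k`): the sum over `a, b, c ≥ 0` with `a - b + c = l - k` of
`(-1) ^ (b + k) q ^ (ac - b + k)` times the ladder with rungs `c` to the left, `b` to the right
and `a` to the left. -/
noncomputable def negCrossing (n k l : ℕ) :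
    ((up k ⊗ up l : NWeb n)) ⟶ (up l ⊗ up k : NWeb n) :=
  ∑ a ∈ Finset.range (k + l + 1), ∑ b ∈ Finset.range (k + l + 1),
    ∑ c ∈ Finset.range (k + l + 1),
      if a + c + k = l + b then
        ((-1) ^ (b + k) * qpow ((a : ℤ) * c - b + k) : QRing) •
          (web (rungLeft c k l (k + c) (l - c)) ≫
            web (rungRight b (k + c) (l - c) (k + c - b) (l - c + b)) ≫
            web (rungLeft a (k + c - b) (l - c + b) l k))
      else 0

/-- Diagrams of web-tangles (knotted webs): planar diagrams built from cups, caps, trivalent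
vertices and crossings.  Crossings are drawn with both strands going up; other orientations are
obtained by rotating a crossing with cups and caps. -/
inductive Diagram (n : ℕ) : NWeb n → NWeb n → Type
  | id (X : NWeb n) : Diagram n X X
  | comp {X Y Z : NWeb n} (f : Diagram n X Y) (g : Diagram n Y Z) : Diagram n X Z
  | tensor {X Y X' Y' : NWeb n} (f : Diagram n X Y) (g : Diagram n X' Y') :
      Diagram n (X.tensor X') (Y.tensor Y')
  | assocHom (X Y Z : NWeb n) : Diagram n ((X.tensor Y).tensor Z) (X.tensor (Y.tensor Z))
  | assocInv (X Y Z : NWeb n) : Diagram n (X.tensor (Y.tensor Z)) ((X.tensor Y).tensor Z)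
  | leftHom (X : NWeb n) : Diagram n (unit.tensor X) X
  | leftInv (X : NWeb n) : Diagram n X (unit.tensor X)
  | rightHom (X : NWeb n) : Diagram n (X.tensor unit) X
  | rightInv (X : NWeb n) : Diagram n X (X.tensor unit)
  | cupUD (k : ℕ) : Diagram n unit ((up k).tensor (down k))
  | cupDU (k : ℕ) : Diagram n unit ((down k).tensor (up k))
  | capUD (k : ℕ) : Diagram n ((up k).tensor (down k)) unit
  | capDU (k : ℕ) : Diagram n ((down k).tensor (up k)) unit
  | merge (k l m : ℕ) (h : k + l = m) : Diagram n ((up k).tensor (up l)) (up m)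
  | split (k l m : ℕ) (h : k + l = m) : Diagram n (up m) ((up k).tensor (up l))
  /-- the strand from bottom left to top right (labelled `k`) is over -/
  | crossPos (k l : ℕ) : Diagram n ((up k).tensor (up l)) ((up l).tensor (up k))
  /-- the strand from bottom right to top left (labelled `l`) is over -/
  | crossNeg (k l : ℕ) : Diagram n ((up k).tensor (up l)) ((up l).tensor (up k))

/-- The bracket `Ψ` from diagrams of web-tangles to the skein module, defined locally by the
smoothing of crossings. -/
noncomputable def Psi : {X Y : NWeb n} → Diagram n X Y → (X ⟶ Y)
  | _, _, .id X => 𝟙 X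
  | _, _, .comp f g => Psi f ≫ Psi g
  | _, _, .tensor f g => Psi f ⊗ₘ Psi g
  | _, _, .assocHom X Y Z => (α_ X Y Z).hom
  | _, _, .assocInv X Y Z => (α_ X Y Z).inv
  | _, _, .leftHom X => (λ_ X).hom
  | _, _, .leftInv X => (λ_ X).inv
  | _, _, .rightHom X => (ρ_ X).hom
  | _, _, .rightInv X => (ρ_ X).inv
  | _, _, .cupUD k => web (WebTerm.cupUD k)
  | _, _, .cupDU k => web (WebTerm.cupDU k)
  | _, _, .capUD k => web (WebTerm.capUD k)
  | _, _, .capDU k => web (WebTerm.capDU k)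
  | _, _, .merge k l m h => web (WebTerm.merge k l m h)
  | _, _, .split k l m h => web (WebTerm.split k l m h)
  | _, _, .crossPos k l => posCrossing n k l
  | _, _, .crossNeg k l => negCrossing n k l

/-- The plain upward strand labelled `k`. -/
def strand (n k : ℕ) : Diagram n (up k) (up k) := .id (up k)

/-- The positive framing twist on an upward strand labelled `k`, drawn (with the framing of the
plane) as a curl to the right: a positive crossing of the strand with itself, whose right ends are
joined by an arc to its right. -/
def twistRight (n k : ℕ) : Diagram n (up k) (up k) :=
  .comp (.rightInv (up k)) <| .comp (.tensor (.id (up k)) (.cupUD k)) <|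
  .comp (.assocInv _ _ _) <| .comp (.tensor (.crossPos k k) (.id (down k))) <|
  .comp (.assocHom _ _ _) <| .comp (.tensor (.id (up k)) (.capUD k)) (.rightHom (up k))

/-- The positive framing twist drawn as a curl to the left: a positive crossing of the strand with
itself, whose left ends are joined by an arc to its left. -/
def twistLeft (n k : ℕ) : Diagram n (up k) (up k) :=
  .comp (.leftInv (up k)) <| .comp (.tensor (.cupDU k) (.id (up k))) <|
  .comp (.assocHom _ _ _) <| .comp (.tensor (.id (down k)) (.crossPos k k)) <|
  .comp (.assocInv _ _ _) <| .comp (.tensor (.capDU k) (.id (up k))) (.leftHom (up k))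

end SkeinWeb

/-!
The proof computes the two curls by the skein relations alone; no rotation of a vertex is needed.

On two uprights with the same label `k`, the commutation relation for rungs and the merging of
consecutive rungs rewrite each `E^{(a)} F^{(a+c)} E^{(c)}` in the smoothed crossing as a combination
of the ladders `E^{(s)} F^{(s)}`.  For fixed `a` and `s` the coefficient contains the alternating sum
`∑ (-1) ^ t q ^ (t (1 - a)) [a choose t]`, which vanishes unless `a = 0`
(`sum_qbinom_alternating`).  Hence the self-crossing is
`∑ (-1) ^ (s + k) q ^ (s - k) E^{(s)} F^{(s)}` over `0 ≤ s ≤ k` (`posCrossing_self`).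

The rungs `E^{(s)}` and `F^{(s)}` commute when both uprights are labelled `k` (`selfLadder_eq`).
Closing `E^{(s)} F^{(s)}` on the left, or `F^{(s)} E^{(s)}` on the right, produces a `k`-labelled
loop attached to an `s`-strand, which is removed with the factor `[n - s choose k]`; what is left is
a digon, with the factor `[k choose s]` (`leftClosure_selfLadder`, `rightClosure_selfLadder`).

Both curls are therefore multiplication by
`∑ (-1) ^ (s + k) q ^ (s - k) [k choose s] [n - s choose k]`.  This is a `k`-th `q`-difference of the
quantum binomial `[p choose k]` as a function of `p`, and equals the asserted monomial
(`sum_qbinom_mul_qbinom`, `sum_twist`).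
-/

/-! ### Quantum binomial coefficients -/

namespace SkeinWeb

theorem qdiff_ne_zero {x : ℤ} (hx : x ≠ 0) : qdiff x ≠ 0 := by
  intro h
  rw [qdiff, sub_eq_zero] at h
  have h1 := congrArg LaurentPolynomial.degree h
  rw [qpow, qpow, LaurentPolynomial.degree_T, LaurentPolynomial.degree_T, WithBot.coe_inj] at h1
  omega

theorem prod_qdiff_ne_zero (t : ℕ) : ∏ i ∈ Finset.range t, qdiff ((i : ℤ) + 1) ≠ 0 :=
  Finset.prod_ne_zero_iff.2 fun i _ => qdiff_ne_zero (by omega)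

@[simp] theorem qbinom_zero_right (p : ℤ) : qbinom p 0 = 1 := by
  simpa using qbinom_spec p 0

theorem qbinom_eq_zero {m t : ℕ} (h : m < t) : qbinom (m : ℤ) t = 0 := by
  have h1 := qbinom_spec (m : ℤ) t
  rw [Finset.prod_eq_zero (f := fun i : ℕ => qdiff ((m : ℤ) - i)) (Finset.mem_range.2 h)
    (by simp only [qdiff, sub_self, neg_zero])] at h1
  exact (mul_eq_zero.1 h1).resolve_right (prod_qdiff_ne_zero t)

/-- Pascal rules for quantum binomial coefficients come from the ways of writing `[p + 1]` as a
combination of `[p - t]` and `[t + 1]`. -/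
theorem qbinom_succ_succ_of_eq (p : ℤ) (t : ℕ) (u v : QRing)
    (h : u * qdiff (p - t) + v * qdiff ((t : ℤ) + 1) = qdiff (p + 1)) :
    qbinom (p + 1) (t + 1) = u * qbinom p (t + 1) + v * qbinom p t := by
  apply mul_right_cancel₀ (prod_qdiff_ne_zero (t + 1))
  have h1 := qbinom_spec p t
  have h2 := qbinom_spec p (t + 1)
  rw [Finset.prod_range_succ (fun i : ℕ => qdiff (p - i))] at h2
  have h3 : ∀ i : ℕ, p + 1 - ((i + 1 : ℕ) : ℤ) = p - i := by intro i; push_cast; ring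
  have h4 := qbinom_spec (p + 1) (t + 1)
  rw [Finset.prod_range_succ' (fun i : ℕ => qdiff (p + 1 - i))] at h4
  simp only [h3, Nat.cast_zero, sub_zero] at h4
  rw [h4, ← h, add_mul, mul_assoc, h2, Finset.prod_range_succ (fun i : ℕ => qdiff ((i : ℤ) + 1))]
  linear_combination -v * qdiff ((t : ℤ) + 1) * h1

theorem qbinom_succ_succ (p : ℤ) (t : ℕ) :
    qbinom (p + 1) (t + 1) =
      qpow ((t : ℤ) + 1) * qbinom p (t + 1) + qpow ((t : ℤ) - p) * qbinom p t := by
  apply qbinom_succ_succ_of_eq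
  simp only [qdiff, mul_sub, ← qpow_add]
  ring_nf

theorem qbinom_succ_succ' (p : ℤ) (t : ℕ) :
    qbinom (p + 1) (t + 1) =
      qpow (-((t : ℤ) + 1)) * qbinom p (t + 1) + qpow (p - (t : ℤ)) * qbinom p t := by
  apply qbinom_succ_succ_of_eq
  simp only [qdiff, mul_sub, ← qpow_add]
  ring_nf

theorem qbinom_symm_add (s t : ℕ) : qbinom ((s + t : ℕ) : ℤ) t = qbinom ((s + t : ℕ) : ℤ) s := by
  have key : ∀ s t : ℕ, (∏ i ∈ Finset.range t, qdiff (((s + t : ℕ) : ℤ) - i)) *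
      ∏ i ∈ Finset.range s, qdiff ((i : ℤ) + 1) =
        ∏ i ∈ Finset.range (s + t), qdiff ((i : ℤ) + 1) := by
    intro s t
    rw [Finset.prod_range_add, mul_comm]
    conv_lhs => rw [← Finset.prod_range_reflect (fun i : ℕ => qdiff (((s + t : ℕ) : ℤ) - i))]
    congr 1
    refine Finset.prod_congr rfl fun i hi => ?_
    have := Finset.mem_range.1 hi
    congr 1
    omega
  apply mul_right_cancel₀ (mul_ne_zero (prod_qdiff_ne_zero t) (prod_qdiff_ne_zero s))
  rw [← mul_assoc, qbinom_spec, key, mul_comm (∏ i ∈ Finset.range t, _), ← mul_assoc, qbinom_spec,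
    add_comm s t, key]

/-- By the `q`-binomial theorem the sum is `∏ (1 - q ^ (-2 i))` over `0 ≤ i < a`, which vanishes as
soon as there is a factor with `i = 0`.  Pascal's rule makes the sum telescope. -/
theorem sum_qbinom_alternating (a : ℕ) (N : ℕ) (h : a ≤ N) :
    ∑ t ∈ Finset.range (N + 1), (-1) ^ t * qpow ((t : ℤ) * (1 - a)) * qbinom (a : ℤ) t =
      if a = 0 then 1 else 0 := by
  have hN : ∑ t ∈ Finset.range (N + 1), (-1) ^ t * qpow ((t : ℤ) * (1 - a)) * qbinom (a : ℤ) t =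
      ∑ t ∈ Finset.range (a + 1), (-1) ^ t * qpow ((t : ℤ) * (1 - a)) * qbinom (a : ℤ) t := by
    symm
    apply Finset.sum_subset (Finset.range_mono (by omega))
    intro t _ ht
    rw [qbinom_eq_zero (by simpa using ht), mul_zero]
  rw [hN]
  cases a with
  | zero => simp [qpow_zero]
  | succ b =>
    rw [if_neg (by omega), Finset.sum_range_succ']
    have h1 : ∀ t : ℕ, (-1) ^ (t + 1) * qpow (((t + 1 : ℕ) : ℤ) * (1 - ((b + 1 : ℕ) : ℤ))) *
        qbinom ((b + 1 : ℕ) : ℤ) (t + 1) =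
        (-1) ^ (t + 1) * qpow (-((t + 1 : ℕ) : ℤ) * (b + 1)) * qbinom (b : ℤ) (t + 1) -
          (-1) ^ t * qpow (-(t : ℤ) * (b + 1)) * qbinom (b : ℤ) t := by
      intro t
      have e1 : qpow (((t + 1 : ℕ) : ℤ) * (1 - ((b + 1 : ℕ) : ℤ))) * qpow (-((t : ℤ) + 1)) =
          qpow (-((t + 1 : ℕ) : ℤ) * (b + 1)) := by
        rw [← qpow_add]; congr 1; push_cast; ring
      have e2 : qpow (((t + 1 : ℕ) : ℤ) * (1 - ((b + 1 : ℕ) : ℤ))) * qpow ((b : ℤ) - t) =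
          qpow (-(t : ℤ) * (b + 1)) := by
        rw [← qpow_add]; congr 1; push_cast; ring
      rw [← e1, ← e2, Nat.cast_succ b, qbinom_succ_succ']
      ring
    simp only [h1]
    rw [Finset.sum_range_sub (fun t : ℕ =>
      (-1) ^ t * qpow (-(t : ℤ) * (b + 1)) * qbinom (b : ℤ) t), qbinom_eq_zero (by omega : b < b + 1)]
    simp [qpow_zero]

/-- The `k`-th `q`-difference of a quantum binomial coefficient, in the upper entry: it lowers the
lower entry by `k`. -/
theorem sum_qbinom_mul_qbinom (k i : ℕ) (p : ℤ) :
    ∑ s ∈ Finset.range (k + 1), (-1) ^ s * qpow ((s : ℤ) * (i + 1)) * qbinom (k : ℤ) s *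
        qbinom (p - s) (i + k) =
      qpow ((k : ℤ) * (i + k - p)) * qbinom (p - k) i := by
  induction k generalizing i p with
  | zero => simp [qpow_zero]
  | succ k ih =>
    have h1 := ih (i + 1) p
    have h2 := ih (i + 1) (p - 1)
    rw [show i + 1 + k = i + (k + 1) by ring] at h1 h2
    -- the range of `h1` is enlarged by a vanishing term, to match Pascal's rule
    have h1' : ∑ s ∈ Finset.range (k + 1 + 1), (-1) ^ s * qpow ((s : ℤ) * (((i + 1 : ℕ) : ℤ) + 1)) *
        qbinom (k : ℤ) s * qbinom (p - s) (i + (k + 1)) =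
          qpow ((k : ℤ) * (((i + 1 : ℕ) : ℤ) + k - p)) * qbinom (p - k) (i + 1) := by
      rw [Finset.sum_range_succ, h1, qbinom_eq_zero (by omega : k < k + 1)]
      simp
    rw [Finset.sum_range_succ'] at h1' ⊢
    have h3 : ∀ s : ℕ, (-1) ^ (s + 1) * qpow (((s + 1 : ℕ) : ℤ) * ((i : ℤ) + 1)) *
        qbinom ((k + 1 : ℕ) : ℤ) (s + 1) * qbinom (p - ((s + 1 : ℕ) : ℤ)) (i + (k + 1)) =
        (-1) ^ (s + 1) * qpow (((s + 1 : ℕ) : ℤ) * (((i + 1 : ℕ) : ℤ) + 1)) *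
          qbinom (k : ℤ) (s + 1) * qbinom (p - ((s + 1 : ℕ) : ℤ)) (i + (k + 1)) -
        qpow ((i : ℤ) + 1 - k) * ((-1) ^ s * qpow ((s : ℤ) * (((i + 1 : ℕ) : ℤ) + 1)) *
          qbinom (k : ℤ) s * qbinom (p - 1 - s) (i + (k + 1))) := by
      intro s
      have e1 : qpow (((s + 1 : ℕ) : ℤ) * ((i : ℤ) + 1)) * qpow ((s : ℤ) + 1) =
          qpow (((s + 1 : ℕ) : ℤ) * (((i + 1 : ℕ) : ℤ) + 1)) := by
        rw [← qpow_add]; push_cast; ring_nf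
      have e2 : qpow (((s + 1 : ℕ) : ℤ) * ((i : ℤ) + 1)) * qpow ((s : ℤ) - k) =
          qpow ((i : ℤ) + 1 - k) * qpow ((s : ℤ) * (((i + 1 : ℕ) : ℤ) + 1)) := by
        rw [← qpow_add, ← qpow_add]; congr 1; push_cast; ring
      rw [← e1, Nat.cast_succ k, qbinom_succ_succ,
        show p - 1 - (s : ℤ) = p - ((s + 1 : ℕ) : ℤ) by push_cast; ring]
      linear_combination (-1) ^ (s + 1) * qbinom (k : ℤ) s *
        qbinom (p - ((s + 1 : ℕ) : ℤ)) (i + (k + 1)) * e2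
    simp only [h3]
    rw [Finset.sum_sub_distrib, ← Finset.mul_sum, h2]
    have h4 := qbinom_succ_succ (p - k - 1) i
    rw [sub_add_cancel] at h4
    have e3 : qpow ((i : ℤ) + 1 - k) * qpow ((k : ℤ) * (((i + 1 : ℕ) : ℤ) + k - (p - 1))) =
        qpow ((k : ℤ) * (((i + 1 : ℕ) : ℤ) + k - p)) * qpow ((i : ℤ) + 1) := by
      rw [← qpow_add, ← qpow_add]; congr 1; push_cast; ring
    have e4 : qpow ((k : ℤ) * (((i + 1 : ℕ) : ℤ) + k - p)) * qpow ((i : ℤ) - (p - k - 1)) =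
        qpow (((k + 1 : ℕ) : ℤ) * ((i : ℤ) + ((k + 1 : ℕ) : ℤ) - p)) := by
      rw [← qpow_add]; congr 1; push_cast; ring
    rw [h4] at h1'
    rw [← e4, show p - 1 - (k : ℤ) = p - k - 1 by ring,
      show p - ((k + 1 : ℕ) : ℤ) = p - k - 1 by push_cast; ring]
    simp only [Nat.cast_zero, zero_mul, qbinom_zero_right] at h1' ⊢
    linear_combination h1' - qbinom (p - k - 1) (i + 1) * e3

/-- The scalar of the framing twist, as the sum over the closed ladders in the smoothed crossing. -/
theorem sum_twist (n k : ℕ) :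
    ∑ s ∈ Finset.range (k + 1), (-1) ^ (s + k) * qpow ((s : ℤ) - k) *
        (qbinom (k : ℤ) s * qbinom ((n : ℤ) - s) k) =
      (-1) ^ k * qpow (-((k : ℤ) * n)) * qpow ((k : ℤ) * (k - 1)) := by
  have h := sum_qbinom_mul_qbinom k 0 n
  have e : qpow (-((k : ℤ) * n)) * qpow ((k : ℤ) * (k - 1)) =
      qpow (-(k : ℤ)) * qpow ((k : ℤ) * (((0 : ℕ) : ℤ) + k - n)) := by
    rw [← qpow_add, ← qpow_add]; congr 1; push_cast; ring
  rw [qbinom_zero_right, mul_one] at h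
  rw [mul_assoc, e, ← h, Finset.mul_sum, Finset.mul_sum]
  refine Finset.sum_congr rfl fun s _ => ?_
  rw [sub_eq_add_neg, qpow_add, zero_add k]
  rw [Nat.cast_zero, zero_add, mul_one, pow_add]
  ring

/-! ### Partial traces -/

section PartialTrace

universe v u

variable {C : Type u} [Category.{v} C] [MonoidalCategory C]

/-- The closure on the right of a morphism `f : A ⊗ D ⟶ B ⊗ D` by a cup `η` and a cap `ε`. -/
def rightClosure {A B D D' : C} (η : 𝟙_ C ⟶ D ⊗ D') (ε : D ⊗ D' ⟶ 𝟙_ C)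
    (f : A ⊗ D ⟶ B ⊗ D) : A ⟶ B :=
  (ρ_ A).inv ≫ A ◁ η ≫ (α_ A D D').inv ≫ f ▷ D' ≫ (α_ B D D').hom ≫ B ◁ ε ≫ (ρ_ B).hom

/-- The closure on the left of a morphism `f : D ⊗ A ⟶ D ⊗ B` by a cup `η` and a cap `ε`. -/
def leftClosure {A B D D' : C} (η : 𝟙_ C ⟶ D' ⊗ D) (ε : D' ⊗ D ⟶ 𝟙_ C)
    (f : D ⊗ A ⟶ D ⊗ B) : A ⟶ B :=
  (λ_ A).inv ≫ η ▷ A ≫ (α_ D' D A).hom ≫ D' ◁ f ≫ (α_ D' D B).inv ≫ ε ▷ B ≫ (λ_ B).hom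

theorem rightClosure_whiskerRight_comp {A A' B B' D D' : C} (η : 𝟙_ C ⟶ D ⊗ D')
    (ε : D ⊗ D' ⟶ 𝟙_ C) (g : A' ⟶ A) (f : A ⊗ D ⟶ B ⊗ D) (h : B ⟶ B') :
    rightClosure η ε (g ▷ D ≫ f ≫ h ▷ D) = g ≫ rightClosure η ε f ≫ h := by
  simp only [rightClosure, comp_whiskerRight, Category.assoc]
  rw [← associator_inv_naturality_left_assoc, whisker_exchange_assoc,
    ← rightUnitor_inv_naturality_assoc, associator_naturality_left_assoc,
    ← whisker_exchange_assoc, rightUnitor_naturality]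

theorem rightClosure_whiskerLeft {A B B' D D' : C} (η : 𝟙_ C ⟶ D ⊗ D')
    (ε : D ⊗ D' ⟶ 𝟙_ C) (f : B ⊗ D ⟶ B' ⊗ D) :
    rightClosure η ε ((α_ A B D).hom ≫ A ◁ f ≫ (α_ A B' D).inv) = A ◁ rightClosure η ε f := by
  simp only [rightClosure]
  monoidal

theorem leftClosure_whiskerLeft_comp {A A' B B' D D' : C} (η : 𝟙_ C ⟶ D' ⊗ D)
    (ε : D' ⊗ D ⟶ 𝟙_ C) (g : A' ⟶ A) (f : D ⊗ A ⟶ D ⊗ B) (h : B ⟶ B') :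
    leftClosure η ε (D ◁ g ≫ f ≫ D ◁ h) = g ≫ leftClosure η ε f ≫ h := by
  simp only [leftClosure, whiskerLeft_comp, Category.assoc]
  rw [← associator_naturality_right_assoc, ← whisker_exchange_assoc,
    ← leftUnitor_inv_naturality_assoc, associator_inv_naturality_right_assoc,
    whisker_exchange_assoc, leftUnitor_naturality]

theorem leftClosure_whiskerRight {A B B' D D' : C} (η : 𝟙_ C ⟶ D' ⊗ D)
    (ε : D' ⊗ D ⟶ 𝟙_ C) (f : D ⊗ B ⟶ D ⊗ B') :
    leftClosure η ε ((α_ D B A).inv ≫ f ▷ A ≫ (α_ D B' A).hom) = leftClosure η ε f ▷ A := by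
  simp only [leftClosure]
  monoidal

variable [Preadditive C] [MonoidalPreadditive C] {R : Type*} [CommRing R] [Linear R C]
  [MonoidalLinear R C] {ι : Type*}

theorem rightClosure_sum_smul {A B D D' : C} (η : 𝟙_ C ⟶ D ⊗ D') (ε : D ⊗ D' ⟶ 𝟙_ C)
    (S : Finset ι) (c : ι → R) (f : ι → (A ⊗ D ⟶ B ⊗ D)) :
    rightClosure η ε (∑ i ∈ S, c i • f i) = ∑ i ∈ S, c i • rightClosure η ε (f i) := by
  simp only [rightClosure, sum_whiskerRight, MonoidalLinear.smul_whiskerRight,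
    Preadditive.sum_comp, Preadditive.comp_sum, Linear.smul_comp, Linear.comp_smul]

theorem leftClosure_sum_smul {A B D D' : C} (η : 𝟙_ C ⟶ D' ⊗ D) (ε : D' ⊗ D ⟶ 𝟙_ C)
    (S : Finset ι) (c : ι → R) (f : ι → (D ⊗ A ⟶ D ⊗ B)) :
    leftClosure η ε (∑ i ∈ S, c i • f i) = ∑ i ∈ S, c i • leftClosure η ε (f i) := by
  simp only [leftClosure, whiskerLeft_sum, MonoidalLinear.whiskerLeft_smul,
    Preadditive.sum_comp, Preadditive.comp_sum, Linear.smul_comp, Linear.comp_smul]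

end PartialTrace

/-! ### Linear structure of the web category -/

variable {n : ℕ}

open NWeb WebTerm

noncomputable instance : MonoidalPreadditive (NWeb n) where
  whiskerLeft_zero {X Y Z} := by
    have h : ∀ g g' : Y ⟶ Z, X ◁ (g + g') = X ◁ g + X ◁ g' := by
      rintro ⟨g⟩ ⟨g'⟩; exact Quot.sound (WebRel.tensor_add _ g g')
    simpa using h 0 0
  zero_whiskerRight {X Y Z} := by
    have h : ∀ g g' : Y ⟶ Z, (g + g') ▷ X = g ▷ X + g' ▷ X := by
      rintro ⟨g⟩ ⟨g'⟩; exact Quot.sound (WebRel.add_tensor g g' _)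
    simpa using h 0 0
  whiskerLeft_add := by
    rintro _ _ _ ⟨g⟩ ⟨g'⟩; exact Quot.sound (WebRel.tensor_add _ g g')
  add_whiskerRight := by
    rintro _ _ _ ⟨g⟩ ⟨g'⟩; exact Quot.sound (WebRel.add_tensor g g' _)

noncomputable instance : MonoidalLinear QRing (NWeb n) where
  whiskerLeft_smul := by
    rintro _ _ _ c ⟨g⟩; exact Quot.sound (WebRel.tensor_smul c _ g)
  smul_whiskerRight := by
    rintro c _ _ ⟨g⟩ _; exact Quot.sound (WebRel.smul_tensor c g _)

theorem web_eq_of_rel {X Y : NWeb n} {f g : WebTerm n X Y} (h : WebRel n f g) : web f = web g :=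
  Quot.sound h

theorem web_comp {X Y Z : NWeb n} (f : WebTerm n X Y) (g : WebTerm n Y Z) :
    web (f.comp g) = web f ≫ web g := rfl

theorem web_smul {X Y : NWeb n} (c : QRing) (f : WebTerm n X Y) :
    web (WebTerm.smul c f) = c • web f := rfl

theorem web_sum {X Y : NWeb n} (f : ℕ → WebTerm n X Y) (m : ℕ) :
    web (WebTerm.sum f m) = ∑ i ∈ Finset.range m, web (f i) := by
  induction m with
  | zero => rfl
  | succ m ih => rw [Finset.sum_range_succ, ← ih]; rfl

/-! ### Ladders and the smoothed self-crossing -/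

theorem web_rungRight {s k l k' l' : ℕ} (h : k' + s = k) (h' : s + l = l') :
    (web (rungRight s k l k' l') : (up k ⊗ up l : NWeb n) ⟶ up k' ⊗ up l') =
      web (split k' s k h) ▷ up l ≫ (α_ _ _ _).hom ≫ up k' ◁ web (merge s l l' h') := by
  rw [rungRight, dif_pos ⟨h, h'⟩]
  rfl

theorem web_rungLeft {s k l k' l' : ℕ} (h : k + s = k') (h' : s + l' = l) :
    (web (rungLeft s k l k' l') : (up k ⊗ up l : NWeb n) ⟶ up k' ⊗ up l') =
      up k ◁ web (split s l' l h') ≫ (α_ _ _ _).inv ≫ web (merge k s k' h) ▷ up l' := by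
  rw [rungLeft, dif_pos ⟨h, h'⟩]
  rfl

theorem web_rungRight_eq_zero {s k l k' l' : ℕ} (h : ¬ (k' + s = k ∧ s + l = l')) :
    (web (rungRight s k l k' l') : (up k ⊗ up l : NWeb n) ⟶ up k' ⊗ up l') = 0 := by
  rw [rungRight, dif_neg h]
  rfl

theorem web_rungLeft_eq_zero {s k l k' l' : ℕ} (h : ¬ (k + s = k' ∧ s + l' = l)) :
    (web (rungLeft s k l k' l') : (up k ⊗ up l : NWeb n) ⟶ up k' ⊗ up l') = 0 := by
  rw [rungLeft, dif_neg h]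
  rfl

/-- The ladder `E^{(s)} F^{(s)}` on two uprights labelled `k`. -/
noncomputable def selfLadder (n k s : ℕ) : (up k ⊗ up k : NWeb n) ⟶ up k ⊗ up k :=
  web (rungLeft s k k (k + s) (k - s)) ≫ web (rungRight s (k + s) (k - s) k k)

theorem selfLadder_eq_zero {k s : ℕ} (h : k < s) : selfLadder n k s = 0 := by
  rw [selfLadder, web_rungLeft_eq_zero (by omega), Limits.zero_comp]

/-- The rungs `E^{(s)}` and `F^{(s)}` commute on two uprights with equal labels. -/
theorem selfLadder_eq (k s : ℕ) : selfLadder n k s =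
    web (rungRight s k k (k - s) (k + s)) ≫ web (rungLeft s (k - s) (k + s) k k) := by
  have h := web_eq_of_rel (WebRel.rungRight_rungLeft (n := n) s s k k k k)
  have h0 : ∀ t : ℕ, qbinom ((k : ℤ) - k + s - s) (t + 1) = 0 := fun t => by
    rw [sub_self, zero_add, sub_self]
    exact qbinom_eq_zero (m := 0) (by omega)
  rw [web_sum, Finset.sum_range_succ'] at h
  simp only [web_smul, h0, zero_smul, Finset.sum_const_zero, zero_add, qbinom_zero_right,
    one_smul] at h
  exact h.symm

/-- Reduction of `E^{(a)} F^{(a+c)} E^{(c)}` to the ladders `E^{(u)} F^{(u)}`: the two lower rungs are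
exchanged, and the two rungs to the right are then merged. -/
theorem rungRight_rungLeft_rungRight {k a c : ℕ} (hc : c ≤ k) (ha : a ≤ k) :
    (web (rungRight c k k (k - c) (k + c)) ≫
      web (rungLeft (a + c) (k - c) (k + c) (k - c + (a + c)) (k + c - (a + c))) ≫
      web (rungRight a (k - c + (a + c)) (k + c - (a + c)) k k) :
        (up k ⊗ up k : NWeb n) ⟶ up k ⊗ up k) =
    ∑ w ∈ Finset.range (c + 1),
      (qbinom (a : ℤ) (c - w) * qbinom ((a : ℤ) + w) a) • selfLadder n k (a + w) := by
  have h := web_eq_of_rel (WebRel.rungRight_rungLeft (n := n) (a + c) c k k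
    (k - c + (a + c)) (k + c - (a + c)))
  rw [web_comp, web_sum, min_eq_right (by omega), ← Finset.sum_range_reflect] at h
  rw [← Category.assoc, h, Preadditive.sum_comp]
  refine Finset.sum_congr rfl fun w hw => ?_
  have hw' : w ≤ c := Nat.lt_succ_iff.1 (Finset.mem_range.1 hw)
  have e1 : a + c - (c + 1 - 1 - w) = a + w := by omega
  have e2 : c - (c + 1 - 1 - w) = w := by omega
  have e3 : c + 1 - 1 - w = c - w := by omega
  rw [e1, e2, e3, web_smul, web_comp, Linear.smul_comp, Category.assoc, mul_smul,
    show (k : ℤ) - k + ((a + c : ℕ) : ℤ) - c = a by push_cast; ring]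
  congr 1
  by_cases hk : a + w ≤ k
  · have e4 : k - c + (a + c) = k + (a + w) - w := by omega
    have e5 : k + c - (a + c) = k - (a + w) + w := by omega
    have h' := web_eq_of_rel (WebRel.rungRight_rungRight (n := n) a w (k + (a + w)) (k - (a + w))
      k k)
    rw [web_comp, web_smul] at h'
    rw [e4, e5, h', Linear.comp_smul, selfLadder]
  · rw [selfLadder_eq_zero (by omega), web_rungLeft_eq_zero (by omega), Limits.zero_comp, smul_zero]

/-- On two uprights with equal labels the three-rung formula for the positive crossing collapses to
an alternating sum of the ladders `E^{(s)} F^{(s)}`, the terms with `a = 0`. -/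
theorem posCrossing_self (n k : ℕ) : posCrossing n k k =
    ∑ s ∈ Finset.range (k + 1),
      ((-1) ^ (s + k) * qpow ((s : ℤ) - k) : QRing) • selfLadder n k s := by
  -- only the ladders with `a, c ≤ k` and `b = a + c` contribute
  have h1 : posCrossing n k k = ∑ a ∈ Finset.range (k + 1), ∑ c ∈ Finset.range (k + 1),
      ∑ w ∈ Finset.range (c + 1),
        (((-1) ^ (a + c + k) * qpow (-((a : ℤ) * c) + (a + c) - k)) *
          (qbinom (a : ℤ) (c - w) * qbinom ((a : ℤ) + w) a)) • selfLadder n k (a + w) := by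
    rw [posCrossing]
    symm
    apply Finset.sum_subset_zero_on_sdiff (Finset.range_mono (by omega))
    · intro a ha
      refine Finset.sum_eq_zero fun b _ => Finset.sum_eq_zero fun c _ => ?_
      simp only [Finset.mem_sdiff, Finset.mem_range] at ha
      split_ifs
      · rw [web_rungRight_eq_zero (s := a) (by omega), Limits.comp_zero, Limits.comp_zero,
          smul_zero]
      · rfl
    intro a ha
    have ha' : a ≤ k := Nat.lt_succ_iff.1 (Finset.mem_range.1 ha)
    rw [Finset.sum_comm]
    apply Finset.sum_subset_zero_on_sdiff (Finset.range_mono (by omega))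
    · intro c hc
      refine Finset.sum_eq_zero fun b _ => ?_
      simp only [Finset.mem_sdiff, Finset.mem_range] at hc
      split_ifs
      · rw [web_rungRight_eq_zero (s := c) (by omega), Limits.zero_comp, smul_zero]
      · rfl
    intro c hc
    have hc' : c ≤ k := Nat.lt_succ_iff.1 (Finset.mem_range.1 hc)
    symm
    rw [Finset.sum_eq_single (a + c), if_pos (by omega), rungRight_rungLeft_rungRight hc' ha',
      Finset.smul_sum]
    · simp only [mul_smul, Nat.cast_add]
    · intro b _ hb
      rw [if_neg (by omega)]
    · intro h
      exact absurd (Finset.mem_range.2 (by omega)) h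
  -- after the exchange of `c` and `w`, the inner sums vanish for `a > 0`
  have h2 : ∀ a ∈ Finset.range (k + 1), (∑ c ∈ Finset.range (k + 1),
      ∑ w ∈ Finset.range (c + 1),
        (((-1) ^ (a + c + k) * qpow (-((a : ℤ) * c) + (a + c) - k)) *
          (qbinom (a : ℤ) (c - w) * qbinom ((a : ℤ) + w) a)) • selfLadder n k (a + w)) =
      if a = 0 then ∑ s ∈ Finset.range (k + 1),
        ((-1) ^ (s + k) * qpow ((s : ℤ) - k) : QRing) • selfLadder n k s else 0 := by
    intro a _
    have h3 := Finset.sum_range_diag_flip (k + 1) (fun w t =>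
      (((-1) ^ (a + (w + t) + k) * qpow (-((a : ℤ) * (w + t)) + (a + (w + t)) - k)) *
          (qbinom (a : ℤ) t * qbinom ((a : ℤ) + w) a)) • selfLadder n k (a + w))
    have h4 : ∀ w ∈ Finset.range (k + 1), (∑ t ∈ Finset.range (k + 1 - w),
        (((-1) ^ (a + (w + t) + k) * qpow (-((a : ℤ) * (w + t)) + (a + (w + t)) - k)) *
          (qbinom (a : ℤ) t * qbinom ((a : ℤ) + w) a)) • selfLadder n k (a + w)) =
        if a = 0 then ((-1) ^ (w + k) * qpow ((w : ℤ) - k) : QRing) • selfLadder n k w else 0 := by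
      intro w hw
      have hw' : w ≤ k := Nat.lt_succ_iff.1 (Finset.mem_range.1 hw)
      by_cases hk : a + w ≤ k
      · have h5 := sum_qbinom_alternating a (k - w) (by omega)
        have h6 : ∀ t : ℕ, ((-1) ^ (a + (w + t) + k) *
            qpow (-((a : ℤ) * (w + t)) + (a + (w + t)) - k)) *
            (qbinom (a : ℤ) t * qbinom ((a : ℤ) + w) a) =
            ((-1) ^ (a + w + k) * qpow (-((a : ℤ) * w) + (a + w) - k) *
              qbinom ((a : ℤ) + w) a) *
              ((-1) ^ t * qpow ((t : ℤ) * (1 - a)) * qbinom (a : ℤ) t) := by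
          intro t
          rw [show -((a : ℤ) * (w + t)) + (a + (w + t)) - k =
            (-((a : ℤ) * w) + (a + w) - k) + (t : ℤ) * (1 - a) by ring, qpow_add]
          ring
        rw [← Finset.sum_smul, Finset.sum_congr rfl fun t _ => h6 t, ← Finset.mul_sum,
          show k + 1 - w = k - w + 1 by omega, h5]
        split_ifs with ha
        · subst ha
          simp
        · rw [mul_zero, zero_smul]
      · rw [selfLadder_eq_zero (by omega), if_neg (by omega)]
        simp
    rw [Finset.sum_congr rfl h4] at h3
    rw [Finset.sum_congr rfl fun c _ => Finset.sum_congr rfl fun w hw => ?_, h3]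
    · split_ifs <;> simp
    · have hw' : w ≤ c := Nat.lt_succ_iff.1 (Finset.mem_range.1 hw)
      have e : (w : ℤ) + ((c - w : ℕ) : ℤ) = c := by omega
      rw [Nat.add_sub_cancel' hw', e]
  rw [h1, Finset.sum_congr rfl h2, Finset.sum_ite_eq' (Finset.range (k + 1)) 0,
    if_pos (by simp)]

/-! ### Closing the ladders -/

theorem rightClosure_merge_split (k l m : ℕ) (h : k + l = m) :
    rightClosure (web (WebTerm.cupUD l)) (web (WebTerm.capUD l))
      (web (merge k l m h) ≫ web (split k l m h) : (up k ⊗ up l : NWeb n) ⟶ up k ⊗ up l) =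
      qbinom ((n : ℤ) - k) l • 𝟙 (up k) :=
  web_eq_of_rel (WebRel.loop_right k l m h)

theorem leftClosure_merge_split (k l m : ℕ) (h : l + k = m) :
    leftClosure (web (WebTerm.cupDU l)) (web (WebTerm.capDU l))
      (web (merge l k m h) ≫ web (split l k m h) : (up l ⊗ up k : NWeb n) ⟶ up l ⊗ up k) =
      qbinom ((n : ℤ) - k) l • 𝟙 (up k) :=
  web_eq_of_rel (WebRel.loop_left k l m h)

theorem split_merge (k l m : ℕ) (h : k + l = m) :
    (web (split k l m h) ≫ web (merge k l m h) : (up m : NWeb n) ⟶ up m) =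
      qbinom (m : ℤ) l • 𝟙 (up m) :=
  web_eq_of_rel (WebRel.digon k l m h)

/-- In the form `F^{(s)} E^{(s)}` the right upright and its closing arc form a `k`-labelled loop
attached to the rung, an `s`-strand; its removal leaves a digon with edges `k - s` and `s`. -/
theorem rightClosure_selfLadder {k s : ℕ} (h : s ≤ k) :
    rightClosure (web (WebTerm.cupUD k)) (web (WebTerm.capUD k)) (selfLadder n k s) =
      (qbinom (k : ℤ) s * qbinom ((n : ℤ) - s) k) • 𝟙 (up k) := by
  have h1 : k - s + s = k := by omega
  have h2 : selfLadder n k s = web (split (k - s) s k h1) ▷ up k ≫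
      ((α_ _ _ _).hom ≫ up (k - s) ◁ (web (merge s k (k + s) (add_comm s k)) ≫
        web (split s k (k + s) (add_comm s k))) ≫ (α_ _ _ _).inv) ≫
      web (merge (k - s) s k h1) ▷ up k := by
    rw [selfLadder_eq, web_rungRight h1 (add_comm s k), web_rungLeft h1 (add_comm s k)]
    simp only [whiskerLeft_comp, Category.assoc]
  rw [h2, rightClosure_whiskerRight_comp, rightClosure_whiskerLeft, rightClosure_merge_split,
    MonoidalLinear.whiskerLeft_smul, whiskerLeft_id, Linear.smul_comp, Linear.comp_smul]
  refine (congrArg _ ((congrArg _ (Category.id_comp _)).trans (split_merge _ _ _ h1))).trans ?_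
  rw [smul_smul, mul_comm]

/-- In the form `E^{(s)} F^{(s)}` the left upright and its closing arc form a `k`-labelled loop
attached to the rung, an `s`-strand; its removal leaves a digon with edges `s` and `k - s`. -/
theorem leftClosure_selfLadder {k s : ℕ} (h : s ≤ k) :
    leftClosure (web (WebTerm.cupDU k)) (web (WebTerm.capDU k)) (selfLadder n k s) =
      (qbinom (k : ℤ) s * qbinom ((n : ℤ) - s) k) • 𝟙 (up k) := by
  have h1 : s + (k - s) = k := by omega
  have h2 : selfLadder n k s = up k ◁ web (split s (k - s) k h1) ≫
      ((α_ _ _ _).inv ≫ (web (merge k s (k + s) rfl) ≫ web (split k s (k + s) rfl)) ▷ up (k - s) ≫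
        (α_ _ _ _).hom) ≫ up k ◁ web (merge s (k - s) k h1) := by
    rw [selfLadder, web_rungRight rfl h1, web_rungLeft rfl h1]
    simp only [comp_whiskerRight, Category.assoc]
  have h3 := qbinom_symm_add s (k - s)
  rw [h1] at h3
  rw [h2, leftClosure_whiskerLeft_comp, leftClosure_whiskerRight, leftClosure_merge_split,
    MonoidalLinear.smul_whiskerRight, id_whiskerRight, Linear.smul_comp, Linear.comp_smul]
  refine (congrArg _ ((congrArg _ (Category.id_comp _)).trans (split_merge _ _ _ h1))).trans ?_
  rw [smul_smul, mul_comm, h3]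

theorem Psi_twistRight (n k : ℕ) : Psi (twistRight n k) =
    rightClosure (web (WebTerm.cupUD k)) (web (WebTerm.capUD k)) (posCrossing n k k) := by
  simp [twistRight, Psi, rightClosure]

theorem Psi_twistLeft (n k : ℕ) : Psi (twistLeft n k) =
    leftClosure (web (WebTerm.cupDU k)) (web (WebTerm.capDU k)) (posCrossing n k k) := by
  simp [twistLeft, Psi, leftClosure]

end SkeinWeb

theorem mainTheorem2 (n k : ℕ) (hk : 1 ≤ k) (hkn : k ≤ n) :
    SkeinWeb.Psi (SkeinWeb.twistRight n k) =
        ((-1) ^ k * SkeinWeb.qpow (-((k : ℤ) * n)) * SkeinWeb.qpow ((k : ℤ) * (k - 1)) :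
          SkeinWeb.QRing) • SkeinWeb.Psi (SkeinWeb.strand n k) ∧
      SkeinWeb.Psi (SkeinWeb.twistLeft n k) =
        ((-1) ^ k * SkeinWeb.qpow (-((k : ℤ) * n)) * SkeinWeb.qpow ((k : ℤ) * (k - 1)) :
          SkeinWeb.QRing) • SkeinWeb.Psi (SkeinWeb.strand n k) := by
  rw [← SkeinWeb.sum_twist, SkeinWeb.Psi_twistRight, SkeinWeb.Psi_twistLeft,
    SkeinWeb.posCrossing_self, SkeinWeb.rightClosure_sum_smul, SkeinWeb.leftClosure_sum_smul,
    SkeinWeb.strand, SkeinWeb.Psi, Finset.sum_smul]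
  refine ⟨Finset.sum_congr rfl fun s hs => ?_, Finset.sum_congr rfl fun s hs => ?_⟩
  · rw [SkeinWeb.rightClosure_selfLadder
      (Nat.lt_succ_iff.1 (Finset.mem_range.1 hs)), smul_smul]
  · rw [SkeinWeb.leftClosure_selfLadder
      (Nat.lt_succ_iff.1 (Finset.mem_range.1 hs)), smul_smul]
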